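/- Let $\Bbbk$ be a field. Tree monomials are the planar binary trees whose internal vertices are labelled by $x$ or $y$; $\mathbf 1$ is the tree with a single leaf, $x(u,v)$ and $y(u,v)$ are the trees with root labelled $x$, resp. $y$, and subtrees $u,v$, and the arity is the number of leaves. Let $\mathrm{noncom}\text{-}\mathrm{Bicom}$ be the nonsymmetric operad over $\Bbbk$ generated by two binary operations $x=(x_1\prec x_2)$ and $y=(x_1\succ x_2)$ with the defining relations $$x_1\succ(x_2\prec x_3)=(x_1\succ x_2)\prec x_3,\qquad x_1\prec(x_2\succ x_3)=(x_1\prec x_2)\succ x_3,$$ that is, the quotient of the free nonsymmetric operad (whose component of arity $n$ has the tree monomials of arity $n$ as a basis) by the operadic ideal generated by these relations. Call a tree monomial normal if it contains none of the divisors $$x(*,\underbrace{x(x(\cdots x}_{m}(y(*,*),*)\cdots),*)),\qquad y(*,\underbrace{y(y(\cdots y}_{m}(x(*,*),*)\cdots),*)),\qquad m\ge 0,$$ i.e. if no subtree of it is obtained from one of these trees by substituting trees for the leaves $*$. Theorem. For every $n\ge 1$: (a) $\dim \mathrm{noncom}\text{-}\mathrm{Bicom}(n)=\binom{2n-2}{n-1}$.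 (b) The classes of the normal tree monomials of arity $n$ (one for each such monomial) form a basis of $\mathrm{noncom}\text{-}\mathrm{Bicom}(n)$. (c) A tree monomial is normal if and only if it is $\mathbf 1$, or $x(u,\alpha)$ with $u$ normal and all internal vertices of $\alpha$ labelled by $x$, or $y(u,\beta)$ with $u$ normal and all internal vertices of $\beta$ labelled by $y$. (d) Define words in the letters $E,N$ by $\delta(\mathbf 1)=\varepsilon$ (the empty word), $\delta(x(a,b))=E\,\delta(a)\,N\,\delta(b)$, $\delta(y(a,b))=N\,\delta(a)\,E\,\delta(b)$, and $\Phi(\mathbf 1)=\varepsilon$, $\Phi(x(u,\alpha))=\Phi(u)\,E\,\delta(\alpha)\,N$, $\Phi(y(u,\beta))=\Phi(u)\,N\,\delta(\beta)\,E$. Then $\Phi$ is a bijection from the set of normal tree monomials of arity $n$ onto the set of lattice paths from $(0,0)$ to $(n-1,n-1)$ with steps $E=(1,0)$ and $N=(0,1)$. -/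

import Mathlib

namespace NoncomBicom

/-- The two binary generators: `x` is the operation `≺`, `y` is the operation `≻`. -/
inductive Gen : Type
  | x : Gen
  | y : Gen

/-- Planar binary trees with internal vertices labelled by `x` or `y`. The tree `one` is the
trivial tree (a single leaf, the operadic unit); `node .x u v` is `x(u, v)` and `node .y u v`
is `y(u, v)`. -/
inductive Tree : Type
  | one : Tree
  | node : Gen → Tree → Tree → Tree

namespace Tree

/-- The arity of a tree is its number of leaves. -/
def arity : Tree → ℕ
  | one => 1
  | node _ l r => l.arity + r.arity

theorem arity_pos (t : Tree) : 0 < t.arity := by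
  induction t with
  | one => exact Nat.one_pos
  | node c l r hl hr => simp only [arity]; omega

/-- `s.graft i t` replaces the leaf number `i` of `s` (leaves are numbered from left to right,
starting with `0`) by the tree `t`. It is only used for `i < s.arity`. -/
def graft : Tree → ℕ → Tree → Tree
  | one, _, t => t
  | node c l r, i, t =>
      if i < l.arity then node c (l.graft i t) r else node c l (r.graft (i - l.arity) t)

theorem arity_graft (s : Tree) (i : ℕ) (hi : i < s.arity) (t : Tree) :
    (s.graft i t).arity = s.arity + t.arity - 1 := by
  induction s generalizing i with
  | one => simp [graft, arity]
  | node c l r hl hr =>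
    have h1 := t.arity_pos
    have h2 := l.arity_pos
    have h3 := r.arity_pos
    simp only [arity] at hi
    by_cases h : i < l.arity
    · simp only [graft, h, if_true, arity, hl i h]; omega
    · simp only [graft, h, if_false, arity, hr (i - l.arity) (by omega)]; omega

/-- All internal vertices of the tree are labelled by `c`. -/
def OnlyLabel (c : Gen) : Tree → Prop
  | one => True
  | node d l r => d = c ∧ l.OnlyLabel c ∧ r.OnlyLabel c

/-- `p.MatchesRoot t`: the tree `t` is obtained from the pattern `p` by substituting trees for
the leaves of `p`. -/
def MatchesRoot : Tree → Tree → Prop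
  | one, _ => True
  | node _ _ _, one => False
  | node c p q, node d l r => c = d ∧ p.MatchesRoot l ∧ q.MatchesRoot r

/-- `p.Divides t`: the tree monomial `t` contains the tree monomial `p` as a divisor, that is,
some subtree of `t` is obtained from `p` by substituting trees for the leaves of `p`. -/
def Divides (p : Tree) : Tree → Prop
  | one => p.MatchesRoot one
  | node c l r => p.MatchesRoot (node c l r) ∨ p.Divides l ∨ p.Divides r

/-- `c(c(⋯ c(t, 1) ⋯, 1), 1)` with `m` occurrences of the operation `c`. -/
def leftComb (c : Gen) : ℕ → Tree → Tree
  | 0, t => t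
  | m + 1, t => node c (leftComb c m t) one

/-- The leading term `x(*, x(x(⋯ x(y(*, *), *) ⋯), *))`, with `m` inner occurrences of `x`. -/
def leadX (m : ℕ) : Tree := node .x one (leftComb .x m (node .y one one))

/-- The leading term `y(*, y(y(⋯ y(x(*, *), *) ⋯), *))`, with `m` inner occurrences of `y`. -/
def leadY (m : ℕ) : Tree := node .y one (leftComb .y m (node .x one one))

/-- A tree monomial is normal if it has no divisor among the leading terms. -/
def Normal (t : Tree) : Prop := ∀ m : ℕ, ¬ (leadX m).Divides t ∧ ¬ (leadY m).Divides t

end Tree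

/-- The tree monomials of arity `n`. -/
abbrev TreeMon (n : ℕ) : Type := {t : Tree // t.arity = n}

/-- The partial composition `s ∘ᵢ t` of tree monomials. -/
def TreeMon.comp {n m : ℕ} (s : TreeMon n) (i : Fin n) (t : TreeMon m) : TreeMon (n + m - 1) :=
  ⟨s.1.graft i t.1, by
    rw [Tree.arity_graft s.1 i (by rw [s.2]; exact i.2) t.1, s.2, t.2]⟩

section Operad

variable (k : Type*) [Field k]

/-- The component of arity `n` of the free nonsymmetric operad over `k` generated by the two
binary operations `x` and `y`: the vector space with basis the tree monomials of arity `n`. -/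
abbrev Free (n : ℕ) : Type _ := TreeMon n →₀ k

variable {k}

/-- The partial composition `f ∘ᵢ g` in the free operad, the bilinear extension of the partial
composition of tree monomials. -/
noncomputable def Free.comp {n m : ℕ} (f : Free k n) (i : Fin n) (g : Free k m) :
    Free k (n + m - 1) :=
  f.sum fun s a => g.sum fun t b => Finsupp.single (s.comp i t) (a * b)

variable (k)

/-- An ideal of the free nonsymmetric operad: a family of subspaces stable under composition
with arbitrary elements of the operad on either side. -/
structure OperadicIdeal where
  carrier : ∀ n : ℕ, Submodule k (Free k n)
  comp_mem_left : ∀ {n m : ℕ} (f : Free k n) (i : Fin n) (g : Free k m),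
    f ∈ carrier n → f.comp i g ∈ carrier (n + m - 1)
  comp_mem_right : ∀ {n m : ℕ} (f : Free k n) (i : Fin n) (g : Free k m),
    g ∈ carrier m → f.comp i g ∈ carrier (n + m - 1)

/-- The operadic ideal generated by a set of elements of arity `3`. -/
noncomputable def OperadicIdeal.span (R : Set (Free k 3)) : OperadicIdeal k where
  carrier n := ⨅ (J : OperadicIdeal k) (_ : R ⊆ J.carrier 3), J.carrier n
  comp_mem_left f i g hf := by
    simp only [Submodule.mem_iInf] at hf ⊢
    exact fun J hJ => J.comp_mem_left f i g (hf J hJ)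
  comp_mem_right f i g hg := by
    simp only [Submodule.mem_iInf] at hg ⊢
    exact fun J hJ => J.comp_mem_right f i g (hg J hJ)

/-- The monomial `(x₁ ∘_d x₂) ∘_c x₃`, that is, the tree `c(d(*, *), *)`. -/
def leftMon (c d : Gen) : TreeMon 3 := ⟨.node c (.node d .one .one) .one, rfl⟩

/-- The monomial `x₁ ∘_c (x₂ ∘_d x₃)`, that is, the tree `c(*, d(*, *))`. -/
def rightMon (c d : Gen) : TreeMon 3 := ⟨.node c .one (.node d .one .one), rfl⟩

/-- The defining relations `x₁ ≻ (x₂ ≺ x₃) = (x₁ ≻ x₂) ≺ x₃` and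
`x₁ ≺ (x₂ ≻ x₃) = (x₁ ≺ x₂) ≻ x₃`. -/
noncomputable def bicomRelations : Set (Free k 3) :=
  {Finsupp.single (rightMon .y .x) 1 - Finsupp.single (leftMon .x .y) 1,
   Finsupp.single (rightMon .x .y) 1 - Finsupp.single (leftMon .y .x) 1}

/-- The component of arity `n` of the nonsymmetric bicommutative operad: the quotient of the free
nonsymmetric operad on `x`, `y` by the operadic ideal generated by the defining relations. -/
abbrev Component (n : ℕ) : Type _ :=
  Free k n ⧸ (OperadicIdeal.span k (bicomRelations k)).carrier n

/-- The class of a tree monomial of arity `n` in the nonsymmetric bicommutative operad. -/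
noncomputable def monomialClass {n : ℕ} (t : TreeMon n) : Component k n :=
  Submodule.Quotient.mk (Finsupp.single t 1)

end Operad

/-- Steps of lattice paths: east and north. -/
inductive Step : Type
  | E : Step
  | N : Step

/-- The displacement of a step: `E = (1, 0)` and `N = (0, 1)`. -/
def Step.vec : Step → ℕ × ℕ
  | E => (1, 0)
  | N => (0, 1)

/-- Lattice paths from `(0, 0)` to `(m, m)` with steps `E` and `N`, as words in the steps. -/
def latticePaths (m : ℕ) : Set (List Step) := {w | (w.map Step.vec).sum = (m, m)}

/-- The step that opens an excursion from the diagonal for the label: `E` for `x`, `N` for `y`. -/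
def Gen.opening : Gen → Step
  | .x => .E
  | .y => .N

/-- The step that closes it: `N` for `x`, `E` for `y`. -/
def Gen.closing : Gen → Step
  | .x => .N
  | .y => .E

/-- `δ(1) = ε`, `δ(x(a, b)) = E δ(a) N δ(b)` and `δ(y(a, b)) = N δ(a) E δ(b)`. On the trees with
only `x`-vertices this is the standard coding by Dyck words, on the trees with only `y`-vertices
the reflected one. -/
def dyckWord : Tree → List Step
  | .one => []
  | .node c a b => c.opening :: dyckWord a ++ c.closing :: dyckWord b

/-- `Φ(1) = ε`, `Φ(x(u, α)) = Φ(u) E δ(α) N` and `Φ(y(u, β)) = Φ(u) N δ(β) E`. -/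
def pathOf : Tree → List Step
  | .one => []
  | .node c u a => pathOf u ++ c.opening :: dyckWord a ++ [c.closing]

end NoncomBicom

namespace NoncomBicom

/-! ### Normal trees -/

/-! A forbidden divisor with root `c` says that, on the left spine of the right subtree, a run of
`c`'s is followed by the other label. Forbidding this at every vertex makes the right subtree of
each vertex monochromatic of that vertex's label, which is (c). Then `pathOf` cuts a balanced path
at its last excursion from the diagonal: the final step gives the root label, the inside of the
excursion is a Dyck word coding the right subtree, and the rest codes the left subtree. This gives
(d) and the count.

Spanning comes from rewriting. The relations read `c(a, c'(b, d)) = c'(c(a, b), d)` for the two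
labels `c ≠ c'`. Hence a tree containing `c'` can be given the root `c'` (`Cong.onlyLabel_or`), and
`c` is associative when its middle argument has such a form (`Cong.assoc`). Induction on the right
factor then makes any product of normal trees normal.

Independence needs no confluence argument. Balanced paths carry two operations satisfying the
relations (`BalancedPath.op_op`), so evaluation at the empty path is defined on the quotient, and it
sends distinct normal trees to distinct paths, hence to independent basis vectors. -/

/-- The other label. -/
def Gen.other : Gen → Gen
  | .x => .y
  | .y => .x

theorem Gen.ne_other (c : Gen) : c ≠ c.other := by cases c <;> simp [Gen.other]

theorem Gen.other_other (c : Gen) : c.other.other = c := by cases c <;> rfl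

theorem Gen.eq_or_eq_other (c d : Gen) : d = c ∨ d = c.other := by
  cases c <;> cases d <;> simp [Gen.other]

namespace Tree

/-- The leading terms, uniformly in the root label. -/
def lead (c : Gen) (m : ℕ) : Tree := node c one (leftComb c m (node c.other one one))

theorem normal_iff_lead (t : Tree) : t.Normal ↔ ∀ c m, ¬ (lead c m).Divides t :=
  ⟨fun h c m => by cases c; exacts [(h m).1, (h m).2], fun h m => ⟨h .x m, h .y m⟩⟩

theorem normal_one : Normal one := by
  rw [normal_iff_lead]
  intro c m h
  simp [lead, Divides, MatchesRoot] at h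

theorem normal_node_iff (c : Gen) (l r : Tree) :
    (node c l r).Normal ↔
      (∀ m, ¬ (leftComb c m (node c.other one one)).MatchesRoot r) ∧ l.Normal ∧ r.Normal := by
  simp only [normal_iff_lead, Divides, not_or]
  constructor
  · refine fun h => ⟨fun m hm => (h c m).1 ?_, fun d m => (h d m).2.1, fun d m => (h d m).2.2⟩
    simp only [lead, MatchesRoot]
    exact ⟨trivial, trivial, hm⟩
  · rintro ⟨h, hl, hr⟩ d m
    refine ⟨?_, hl d m, hr d m⟩
    simp only [lead, MatchesRoot]
    rintro ⟨rfl, -, hm⟩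
    exact h m hm

theorem OnlyLabel.not_matchesRoot {c : Gen} (m : ℕ) :
    ∀ {r : Tree}, r.OnlyLabel c → ¬ (leftComb c m (node c.other one one)).MatchesRoot r := by
  induction m with
  | zero =>
    intro r hr h
    cases r with
    | one => exact h
    | node d l r => exact c.ne_other (hr.1.symm.trans h.1.symm)
  | succ m ih =>
    intro r hr h
    cases r with
    | one => exact h
    | node d l r => exact ih hr.2.1 h.2.1

theorem OnlyLabel.normal {c : Gen} : ∀ {t : Tree}, t.OnlyLabel c → t.Normal
  | one, _ => normal_one
  | node d l r, h => by
    obtain ⟨rfl, hl, hr⟩ := h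
    exact (normal_node_iff _ _ _).2 ⟨fun m => hr.not_matchesRoot m, hl.normal, hr.normal⟩

/-- The excluded matches force the label `c` all along the left spine of `t`; normality of `t` at
each spine vertex then excludes the same patterns in the right subtree hanging there. -/
theorem Normal.onlyLabel {c : Gen} {t : Tree} (ht : t.Normal)
    (h : ∀ m, ¬ (leftComb c m (node c.other one one)).MatchesRoot t) : t.OnlyLabel c := by
  induction t with
  | one => trivial
  | node d l r hl hr =>
    obtain ⟨h1, h2, h3⟩ := (normal_node_iff _ _ _).1 ht
    rcases c.eq_or_eq_other d with rfl | rfl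
    · exact ⟨rfl, hl h2 fun m hm => h (m + 1) ⟨rfl, hm, trivial⟩, hr h3 h1⟩
    · exact absurd ⟨rfl, trivial, trivial⟩ (h 0)

theorem normal_node_iff_onlyLabel (c : Gen) (u a : Tree) :
    (node c u a).Normal ↔ u.Normal ∧ a.OnlyLabel c := by
  rw [normal_node_iff]
  exact ⟨fun h => ⟨h.2.1, h.2.2.onlyLabel h.1⟩,
    fun h => ⟨fun m => h.2.not_matchesRoot m, h.1, h.2.normal⟩⟩

theorem normal_iff (t : Tree) : t.Normal ↔
    t = .one ∨ (∃ u a : Tree, u.Normal ∧ a.OnlyLabel .x ∧ t = .node .x u a) ∨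
      (∃ u b : Tree, u.Normal ∧ b.OnlyLabel .y ∧ t = .node .y u b) := by
  constructor
  · intro h
    cases t with
    | one => exact Or.inl rfl
    | node c u a =>
      obtain ⟨hu, ha⟩ := (normal_node_iff_onlyLabel c u a).1 h
      cases c
      · exact Or.inr (Or.inl ⟨u, a, hu, ha, rfl⟩)
      · exact Or.inr (Or.inr ⟨u, a, hu, ha, rfl⟩)
  · rintro (rfl | ⟨u, a, hu, ha, rfl⟩ | ⟨u, a, hu, ha, rfl⟩)
    · exact normal_one
    · exact (normal_node_iff_onlyLabel _ _ _).2 ⟨hu, ha⟩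
    · exact (normal_node_iff_onlyLabel _ _ _).2 ⟨hu, ha⟩

end Tree

/-! ### Heights of words -/

/-- The signed weight of a step: `1` for the opening step of `c`, and `-1` for the closing one. -/
def Step.weight : Gen → Step → ℤ
  | .x, .E => 1
  | .x, .N => -1
  | .y, .E => -1
  | .y, .N => 1

/-- The signed distance of the end point of a path from the diagonal, on the side of `c`. -/
def height (c : Gen) (w : List Step) : ℤ := (w.map (Step.weight c)).sum

@[simp] theorem height_nil (c : Gen) : height c [] = 0 := rfl

@[simp] theorem height_cons (c : Gen) (s : Step) (w : List Step) :
    height c (s :: w) = s.weight c + height c w := by simp [height]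

@[simp] theorem height_append (c : Gen) (v w : List Step) :
    height c (v ++ w) = height c v + height c w := by simp [height]

@[simp] theorem weight_opening (c : Gen) : c.opening.weight c = 1 := by cases c <;> rfl

@[simp] theorem weight_closing (c : Gen) : c.closing.weight c = -1 := by cases c <;> rfl

theorem Step.eq_opening_or_closing (c : Gen) (s : Step) : s = c.opening ∨ s = c.closing := by
  cases c <;> cases s <;> simp [Gen.opening, Gen.closing]

theorem opening_other (c : Gen) : c.other.opening = c.closing := by cases c <;> rfl

theorem closing_injective : Function.Injective Gen.closing := by
  intro c d h
  cases c <;> cases d <;> simp_all [Gen.closing]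

theorem weight_other (c : Gen) (s : Step) : s.weight c.other = -s.weight c := by
  cases c <;> cases s <;> rfl

theorem height_other (c : Gen) (w : List Step) : height c.other w = -height c w := by
  induction w with
  | nil => rfl
  | cons s w ih => simp [ih, weight_other]; ring

theorem height_eq_zero_of {c : Gen} (d : Gen) {w : List Step} (h : height c w = 0) :
    height d w = 0 := by
  rcases c.eq_or_eq_other d with rfl | rfl
  · exact h
  · rw [height_other, h, neg_zero]

/-- All points of the path are on the side of `c` of the diagonal. -/
def StaysAbove (c : Gen) (w : List Step) : Prop := ∀ p, p <+: w → 0 ≤ height c p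

/-- A path on the side of `c` that returns to the diagonal. -/
def IsDyck (c : Gen) (w : List Step) : Prop := height c w = 0 ∧ StaysAbove c w

theorem staysAbove_nil (c : Gen) : StaysAbove c [] := by
  intro p hp
  rw [List.prefix_nil.1 hp]
  rfl

theorem StaysAbove.concat {c : Gen} {w : List Step} {s : Step} (h : StaysAbove c w)
    (hs : 0 ≤ height c (w ++ [s])) : StaysAbove c (w ++ [s]) := by
  intro p hp
  rcases List.prefix_concat_iff.1 hp with rfl | hp
  · exact hs
  · exact h p hp

theorem StaysAbove.append {c : Gen} {v w : List Step} (hv : StaysAbove c v)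
    (hw : ∀ p, p <+: w → 0 ≤ height c v + height c p) : StaysAbove c (v ++ w) := by
  intro p hp
  obtain ⟨r, hr⟩ := hp
  rcases List.append_eq_append_iff.1 hr with ⟨q, rfl, -⟩ | ⟨q, rfl, rfl⟩
  · exact hv p (List.prefix_append _ _)
  · rw [height_append]
    exact hw q (List.prefix_append _ _)

theorem isDyck_nil (c : Gen) : IsDyck c [] := ⟨rfl, staysAbove_nil c⟩

theorem IsDyck.append {c : Gen} {v w : List Step} (hv : IsDyck c v) (hw : IsDyck c w) :
    IsDyck c (v ++ w) :=
  ⟨by rw [height_append, hv.1, hw.1, add_zero],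
    hv.2.append fun p hp => by rw [hv.1, zero_add]; exact hw.2 p hp⟩

theorem IsDyck.wrap {c : Gen} {w : List Step} (hw : IsDyck c w) :
    IsDyck c (c.opening :: w ++ [c.closing]) := by
  have h0 : height c (c.opening :: w ++ [c.closing]) = 0 := by simp [hw.1]
  refine ⟨h0, StaysAbove.concat ?_ h0.ge⟩
  intro p hp
  rcases List.prefix_cons_iff.1 hp with rfl | ⟨q, rfl, hq⟩
  · rfl
  · have := hw.2 q hq
    simp only [height_cons, weight_opening]
    omega

/-- The last excursion of a path from the diagonal is determined by the path. -/
theorem append_opening_cons_inj {c : Gen} {P P' Q Q' : List Step} (hP : height c P = 0)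
    (hP' : height c P' = 0) (hQ : IsDyck c Q) (hQ' : IsDyck c Q')
    (h : P ++ c.opening :: Q = P' ++ c.opening :: Q') : P = P' ∧ Q = Q' := by
  have key : ∀ {P P' Q Q' r : List Step}, height c P = 0 → height c P' = 0 → IsDyck c Q →
      P' = P ++ r → c.opening :: Q = r ++ c.opening :: Q' → r = [] := by
    intro P P' Q Q' r hP hP' hQ h1 h2
    cases r with
    | nil => rfl
    | cons s r =>
      simp only [List.cons_append, List.cons.injEq] at h2
      obtain ⟨rfl, rfl⟩ := h2
      -- A nonempty overlap starts with an opening step and continues with a prefix of `Q`, so `P'`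
      -- would end at height at least 1 instead of 0.
      have := hQ.2 r (List.prefix_append _ _)
      rw [h1] at hP'
      simp only [height_append, height_cons, weight_opening] at hP'
      omega
  rcases List.append_eq_append_iff.1 h with ⟨r, h1, h2⟩ | ⟨r, h1, h2⟩
  · obtain rfl := key hP hP' hQ h1 h2
    simp_all
  · obtain rfl := key hP' hP hQ' h1 h2
    simp_all

/-- The first excursion of a path from the diagonal is determined by the path. -/
theorem append_closing_cons_inj {c : Gen} {P P' Q Q' : List Step} (hP : IsDyck c P)
    (hP' : IsDyck c P') (h : P ++ c.closing :: Q = P' ++ c.closing :: Q') : P = P' ∧ Q = Q' := by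
  have key : ∀ {P P' Q Q' r : List Step}, IsDyck c P → IsDyck c P' →
      P' = P ++ r → c.closing :: Q = r ++ c.closing :: Q' → r = [] := by
    intro P P' Q Q' r hP hP' h1 h2
    cases r with
    | nil => rfl
    | cons s r =>
      simp only [List.cons_append, List.cons.injEq] at h2
      obtain ⟨rfl, rfl⟩ := h2
      -- This prefix of `P'` would reach height -1.
      have := hP'.2 (P ++ [c.closing]) ⟨r, by simp [h1]⟩
      simp [hP.1] at this
  rcases List.append_eq_append_iff.1 h with ⟨r, h1, h2⟩ | ⟨r, h1, h2⟩
  · obtain rfl := key hP hP' h1 h2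
    simp_all
  · obtain rfl := key hP' hP h1 h2
    simp_all

/-- The cut is at the last step from height 0 to height 1. Appending a step moves the cut only when
the path was at height 0. -/
theorem exists_last_excursion {c : Gen} (w : List Step) (hw : 1 ≤ height c w) :
    ∃ P Q, w = P ++ c.opening :: Q ∧ height c P = 0 ∧ StaysAbove c Q := by
  induction w using List.reverseRecOn with
  | nil => simp at hw
  | append_singleton w s ih =>
    by_cases h : 1 ≤ height c w
    · obtain ⟨P, Q, rfl, hP, hQ⟩ := ih h
      refine ⟨P, Q ++ [s], by simp, hP, hQ.concat ?_⟩
      simp only [height_append, height_cons, weight_opening, hP] at hw ⊢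
      omega
    · rcases s.eq_opening_or_closing c with rfl | rfl
      · refine ⟨w, [], rfl, ?_, staysAbove_nil c⟩
        simp at hw
        omega
      · simp at hw
        omega

/-- The alternative is a first passage to height -1, with `A` the part before it. -/
theorem staysAbove_or_exists_passage (c : Gen) (w : List Step) :
    StaysAbove c w ∨ ∃ A B, w = A ++ c.closing :: B ∧ IsDyck c A := by
  induction w using List.reverseRecOn with
  | nil => exact Or.inl (staysAbove_nil c)
  | append_singleton w s ih =>
    rcases ih with h | ⟨A, B, rfl, hA⟩
    · by_cases h0 : 0 ≤ height c (w ++ [s])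
      · exact Or.inl (h.concat h0)
      · have := h w (List.prefix_refl w)
        rcases s.eq_opening_or_closing c with rfl | rfl
        · simp at h0
          omega
        · refine Or.inr ⟨w, [], rfl, ?_, h⟩
          simp at h0
          omega
    · exact Or.inr ⟨A, B ++ [s], by simp, hA⟩

/-! ### The coding of trees by words -/

theorem isDyck_dyckWord {c : Gen} : ∀ {t : Tree}, t.OnlyLabel c → IsDyck c (dyckWord t)
  | .one, _ => isDyck_nil c
  | .node d a b, h => by
    obtain ⟨rfl, ha, hb⟩ := h
    have := (isDyck_dyckWord ha).wrap.append (isDyck_dyckWord hb)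
    simpa [dyckWord] using this

theorem dyckWord_inj {c : Gen} : ∀ {s t : Tree}, s.OnlyLabel c → t.OnlyLabel c →
    dyckWord s = dyckWord t → s = t
  | .one, .one, _, _, _ => rfl
  | .one, .node _ _ _, _, _, h => by simp [dyckWord] at h
  | .node _ _ _, .one, _, _, h => by simp [dyckWord] at h
  | .node d a b, .node d' a' b', hs, ht, h => by
    obtain ⟨rfl, ha, hb⟩ := hs
    obtain ⟨rfl, ha', hb'⟩ := ht
    simp only [dyckWord, List.cons_append, List.cons.injEq, true_and] at h
    obtain ⟨h1, h2⟩ := append_closing_cons_inj (isDyck_dyckWord ha) (isDyck_dyckWord ha') h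
    rw [dyckWord_inj ha ha' h1, dyckWord_inj hb hb' h2]

/-- First-return decomposition: after the opening step, the first passage one level down closes the
left factor. -/
theorem exists_dyckWord_eq {c : Gen} (w : List Step) (hw : IsDyck c w) :
    ∃ t : Tree, t.OnlyLabel c ∧ dyckWord t = w := by
  induction hn : w.length using Nat.strong_induction_on generalizing w with
  | _ n ih =>
    cases w with
    | nil => exact ⟨.one, trivial, rfl⟩
    | cons s w =>
      have hs : s = c.opening := by
        rcases s.eq_opening_or_closing c with rfl | rfl
        · rfl
        · have := hw.2 [c.closing] ⟨w, rfl⟩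
          simp at this
      subst hs
      have h0 := hw.1
      rcases staysAbove_or_exists_passage c w with h | ⟨A, B, rfl, hA⟩
      · have := h w (List.prefix_refl w)
        simp at h0
        omega
      · simp only [List.length_cons, List.length_append] at hn
        obtain ⟨a, ha, rfl⟩ := ih A.length (by omega) A hA rfl
        have hB : IsDyck c B := by
          constructor
          · simp [hA.1] at h0
            exact h0
          · intro p hp
            have := hw.2 (c.opening :: dyckWord a ++ c.closing :: p) (by
              simpa [List.prefix_append_right_inj] using hp)
            simpa [hA.1] using this
        obtain ⟨b, hb, rfl⟩ := ih B.length (by omega) B hB rfl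
        exact ⟨.node c a b, ⟨rfl, ha, hb⟩, by simp [dyckWord]⟩

theorem height_dyckWord (c : Gen) : ∀ t : Tree, height c (dyckWord t) = 0
  | .one => rfl
  | .node d a b => by
    apply height_eq_zero_of (c := d)
    simp [dyckWord, height_dyckWord d a, height_dyckWord d b]

theorem height_pathOf (c : Gen) : ∀ t : Tree, height c (pathOf t) = 0
  | .one => rfl
  | .node d u a => by
    apply height_eq_zero_of (c := d)
    simp [pathOf, height_dyckWord, height_pathOf d u]

theorem length_dyckWord : ∀ t : Tree, (dyckWord t).length + 2 = 2 * t.arity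
  | .one => rfl
  | .node d a b => by
    have h1 := length_dyckWord a
    have h2 := length_dyckWord b
    simp [dyckWord, Tree.arity]
    omega

theorem length_pathOf : ∀ t : Tree, (pathOf t).length + 2 = 2 * t.arity
  | .one => rfl
  | .node d u a => by
    have h1 := length_pathOf u
    have h2 := length_dyckWord a
    simp [pathOf, Tree.arity]
    omega

theorem pathOf_inj : ∀ {s t : Tree}, s.Normal → t.Normal → pathOf s = pathOf t → s = t
  | .one, .one, _, _, _ => rfl
  | .one, .node _ _ _, _, _, h => by simp [pathOf] at h
  | .node _ _ _, .one, _, _, h => by simp [pathOf] at h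
  | .node c u a, .node d v b, hs, ht, h => by
    obtain ⟨hu, ha⟩ := (Tree.normal_node_iff_onlyLabel c u a).1 hs
    obtain ⟨hv, hb⟩ := (Tree.normal_node_iff_onlyLabel d v b).1 ht
    obtain ⟨h1, h2⟩ := List.append_inj' h rfl
    obtain rfl : c = d := closing_injective (by simpa using h2)
    obtain ⟨h3, h4⟩ := append_opening_cons_inj (height_pathOf c u) (height_pathOf c v)
      (isDyck_dyckWord ha) (isDyck_dyckWord hb) h1
    rw [pathOf_inj hu hv h3, dyckWord_inj ha hb h4]

theorem exists_pathOf_eq (w : List Step) (hw : height .x w = 0) :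
    ∃ t : Tree, t.Normal ∧ pathOf t = w := by
  induction hn : w.length using Nat.strong_induction_on generalizing w with
  | _ n ih =>
    rcases List.eq_nil_or_concat' w with rfl | ⟨w, s, rfl⟩
    · exact ⟨.one, Tree.normal_one, rfl⟩
    -- The last step determines the root label; before it the path is at height 1 on the side of
    -- `c`.
    · obtain ⟨c, rfl⟩ : ∃ c : Gen, s = c.closing := by
        cases s
        exacts [⟨.y, rfl⟩, ⟨.x, rfl⟩]
      have h0 := height_eq_zero_of c hw
      simp only [height_append, height_cons, weight_closing, height_nil] at h0
      obtain ⟨P, Q, rfl, hP, hQ⟩ := exists_last_excursion (c := c) w (by omega)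
      simp only [List.length_append, List.length_cons] at hn
      obtain ⟨u, hu, rfl⟩ := ih P.length (by omega) P (height_eq_zero_of .x hP) rfl
      have hQ' : IsDyck c Q := by
        refine ⟨?_, hQ⟩
        simp [hP] at h0
        omega
      obtain ⟨a, ha, rfl⟩ := exists_dyckWord_eq Q hQ'
      exact ⟨.node c u a, (Tree.normal_node_iff_onlyLabel c u a).2 ⟨hu, ha⟩, by simp [pathOf]⟩

/-! ### Lattice paths -/

theorem sum_vec (w : List Step) :
    (((w.map Step.vec).sum.1 : ℤ) - (w.map Step.vec).sum.2 = height .x w) ∧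
      (w.map Step.vec).sum.1 + (w.map Step.vec).sum.2 = w.length := by
  induction w with
  | nil => simp
  | cons s w ih =>
    cases s <;> simp [Step.vec, Step.weight] <;> omega

theorem mem_latticePaths_iff (m : ℕ) (w : List Step) :
    w ∈ latticePaths m ↔ height .x w = 0 ∧ w.length = 2 * m := by
  obtain ⟨h1, h2⟩ := sum_vec w
  simp only [latticePaths, Set.mem_ofPred_eq, Prod.ext_iff]
  omega

theorem bijOn_pathOf (n : ℕ) (hn : 1 ≤ n) :
    Set.BijOn pathOf {t : Tree | t.Normal ∧ t.arity = n} (latticePaths (n - 1)) := by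
  refine ⟨?_, fun s hs t ht h => pathOf_inj hs.1 ht.1 h, ?_⟩
  · rintro t ⟨-, rfl⟩
    have := length_pathOf t
    exact (mem_latticePaths_iff _ _).2 ⟨height_pathOf _ t, by omega⟩
  · intro w hw
    obtain ⟨h1, h2⟩ := (mem_latticePaths_iff _ _).1 hw
    obtain ⟨t, ht, rfl⟩ := exists_pathOf_eq w h1
    have := length_pathOf t
    exact ⟨t, ⟨ht, by omega⟩, rfl⟩

/-! ### Counting lattice paths by Pascal's rule. -/

/-- Lattice paths with a prescribed end point. -/
def pathsTo (v : ℕ × ℕ) : Set (List Step) := {w | (w.map Step.vec).sum = v}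

/-- Paths are sorted by their first step; the unions over `0 < a` and `0 < b` discard the cases
where the subtraction truncates. -/
theorem pathsTo_eq (a b : ℕ) (h : 0 < a + b) : pathsTo (a, b) =
    (⋃ _ : 0 < a, List.cons .E '' pathsTo (a - 1, b)) ∪
      ⋃ _ : 0 < b, List.cons .N '' pathsTo (a, b - 1) := by
  ext w
  cases w with
  | nil =>
    simp [pathsTo, Prod.ext_iff]
    omega
  | cons s w =>
    cases s <;> simp [pathsTo, Prod.ext_iff, Step.vec] <;> omega

theorem pathsTo_finite_ncard (n : ℕ) : ∀ a b : ℕ, a + b = n →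
    (pathsTo (a, b)).Finite ∧ (pathsTo (a, b)).ncard = n.choose a := by
  induction n with
  | zero =>
    intro a b h
    obtain ⟨rfl, rfl⟩ : a = 0 ∧ b = 0 := by omega
    have : pathsTo (0, 0) = {[]} := by
      ext w
      cases w with
      | nil => simp [pathsTo, Prod.ext_iff]
      | cons s w => cases s <;> simp [pathsTo, Step.vec, Prod.ext_iff]
    simp [this]
  | succ n ih =>
    intro a b h
    have inj : ∀ s : Step, Function.Injective (List.cons s) := fun s => List.cons_injective
    rw [pathsTo_eq a b (by omega)]
    rcases Nat.eq_zero_or_pos a with rfl | ha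
    · obtain ⟨h1, h2⟩ := ih 0 (b - 1) (by omega)
      have hb : 0 < b := by omega
      simp only [lt_irrefl, Set.iUnion_of_empty, Set.empty_union, hb, Set.iUnion_true]
      exact ⟨h1.image _, by rw [Set.ncard_image_of_injective _ (inj _), h2]; simp⟩
    · obtain ⟨h1, h2⟩ := ih (a - 1) b (by omega)
      rcases Nat.eq_zero_or_pos b with rfl | hb
      · simp only [lt_irrefl, Set.iUnion_of_empty, Set.union_empty, ha, Set.iUnion_true]
        refine ⟨h1.image _, ?_⟩
        rw [Set.ncard_image_of_injective _ (inj _), h2]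
        obtain rfl : a = n + 1 := by omega
        simp
      · obtain ⟨h3, h4⟩ := ih a (b - 1) (by omega)
        simp only [ha, hb, Set.iUnion_true]
        refine ⟨(h1.image _).union (h3.image _), ?_⟩
        rw [Set.ncard_union_eq _ (h1.image _) (h3.image _),
          Set.ncard_image_of_injective _ (inj _), Set.ncard_image_of_injective _ (inj _), h2, h4]
        · obtain ⟨a, rfl⟩ : ∃ a', a = a' + 1 := ⟨a - 1, by omega⟩
          rw [Nat.choose_succ_succ]
          simp
        · rw [Set.disjoint_left]
          rintro _ ⟨v, -, rfl⟩ ⟨w, -, hw⟩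
          simp at hw

theorem ncard_latticePaths (m : ℕ) : (latticePaths m).ncard = (2 * m).choose m := by
  rw [two_mul]
  exact (pathsTo_finite_ncard (m + m) m m rfl).2

end NoncomBicom
namespace NoncomBicom

/-! ### A model of the operad on lattice paths -/

/-- `insertClosing c h w` inserts a closing step of `c` into a path that starts at height `h`
on the side of `c`, at the first moment at which the path is going to leave this side, or at the
end of the path if there is no such moment. -/
def insertClosing (c : Gen) : ℕ → List Step → List Step
  | _, [] => [c.closing]
  | h, s :: w =>
    match c, s with
    | .x, .E => s :: insertClosing c (h + 1) w
    | .y, .N => s :: insertClosing c (h + 1) w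
    | .x, .N => match h with
      | 0 => c.closing :: s :: w
      | h + 1 => s :: insertClosing c h w
    | .y, .E => match h with
      | 0 => c.closing :: s :: w
      | h + 1 => s :: insertClosing c h w

theorem insertClosing_nil (c : Gen) (h : ℕ) : insertClosing c h [] = [c.closing] := by
  cases c <;> rfl

theorem insertClosing_opening (c : Gen) (h : ℕ) (w : List Step) :
    insertClosing c h (c.opening :: w) = c.opening :: insertClosing c (h + 1) w := by
  cases c <;> cases h <;> rfl

theorem insertClosing_closing_zero (c : Gen) (w : List Step) :
    insertClosing c 0 (c.closing :: w) = c.closing :: c.closing :: w := by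
  cases c <;> rfl

theorem insertClosing_closing_succ (c : Gen) (h : ℕ) (w : List Step) :
    insertClosing c (h + 1) (c.closing :: w) = c.closing :: insertClosing c h w := by
  cases c <;> rfl

theorem height_insertClosing (c : Gen) (w : List Step) :
    ∀ h : ℕ, height c (insertClosing c h w) = height c w - 1 := by
  induction w with
  | nil => intro h; simp [insertClosing_nil]
  | cons s w ih =>
    intro h
    rcases s.eq_opening_or_closing c with rfl | rfl
    · rw [insertClosing_opening]
      simp [ih]
    · cases h with
      | zero =>
        rw [insertClosing_closing_zero]
        simp
        ring
      | succ h =>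
        rw [insertClosing_closing_succ]
        simp [ih]
        ring

/-- After `v` the height is 0, so the next closing step would leave the side of `c`: the insertion
happens inside `v` or just before that step, and never reaches `w`. -/
theorem insertClosing_append_closing (c : Gen) (v : List Step) (w : List Step) :
    ∀ h : ℕ, h + height c v = 0 →
      insertClosing c h (v ++ c.closing :: w) = insertClosing c h v ++ c.closing :: w := by
  induction v with
  | nil =>
    intro h hh
    obtain rfl : h = 0 := by simpa using hh
    simp [insertClosing_nil, insertClosing_closing_zero]
  | cons s v ih =>
    intro h hh
    rcases s.eq_opening_or_closing c with rfl | rfl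
    · simp only [List.cons_append, insertClosing_opening]
      rw [ih]
      simp at hh ⊢
      omega
    · cases h with
      | zero => simp [insertClosing_closing_zero]
      | succ h =>
        simp only [List.cons_append, insertClosing_closing_succ]
        rw [ih]
        simp at hh ⊢
        omega

theorem insertClosing_eq_concat (c : Gen) (w : List Step) :
    ∀ h : ℕ, (∀ p, p <+: w → 0 ≤ h + height c p) → insertClosing c h w = w ++ [c.closing] := by
  induction w with
  | nil => intro h _; simp [insertClosing_nil]
  | cons s w ih =>
    intro h hh
    rcases s.eq_opening_or_closing c with rfl | rfl
    · rw [insertClosing_opening, ih, List.cons_append]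
      intro p hp
      have := hh (c.opening :: p) (by simpa [List.cons_prefix_cons] using hp)
      simp at this ⊢
      omega
    · cases h with
      | zero =>
        have := hh [c.closing] ⟨w, rfl⟩
        simp at this
      | succ h =>
        rw [insertClosing_closing_succ, ih, List.cons_append]
        intro p hp
        have := hh (c.closing :: p) (by simpa [List.cons_prefix_cons] using hp)
        simp at this ⊢
        omega

/-- The paths that end on the diagonal. -/
abbrev BalancedPath : Type := {w : List Step // height .x w = 0}

/-- The operations of the path model. -/
def BalancedPath.op (c : Gen) (v w : BalancedPath) : BalancedPath :=
  ⟨v.1 ++ c.opening :: insertClosing c 0 w.1, by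
    apply height_eq_zero_of (c := c)
    simp [height_insertClosing, height_eq_zero_of c v.2, height_eq_zero_of c w.2]⟩

/-- The opening step of the other label is the closing step of `c`. Since `v` is balanced, the
insertion is finished before this step, and both sides become the same concatenation. -/
theorem BalancedPath.op_op (c : Gen) (u v w : BalancedPath) :
    op c u (op c.other v w) = op c.other (op c u v) w := by
  apply Subtype.ext
  simp only [op, opening_other]
  rw [insertClosing_append_closing _ _ _ _ (by simpa using height_eq_zero_of c v.2)]
  simp

/-! ### Evaluation of trees and its compatibility with grafting. -/

/-- The value of a tree in a magma with two operations, the leaf number `i` taking the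
value `f i`. -/
def Tree.eval {M : Type*} (op : Gen → M → M → M) : Tree → (ℕ → M) → M
  | one, f => f 0
  | node c l r, f => op c (l.eval op f) (r.eval op fun j => f (l.arity + j))

theorem Tree.eval_congr {M : Type*} (op : Gen → M → M → M) (s : Tree) {f g : ℕ → M}
    (h : ∀ j < s.arity, f j = g j) : s.eval op f = s.eval op g := by
  induction s generalizing f g with
  | one => exact h 0 Nat.one_pos
  | node c l r hl hr =>
    simp only [arity] at h
    simp only [eval]
    rw [hl fun j hj => h j (by omega), hr fun j hj => h _ (by omega)]

/-- The assignment of values to the leaves of `s` whose value is that of the assignment `f` to the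
leaves of the tree obtained by grafting a tree of arity `m` and value `v` at the leaf `i`. -/
def graftAssignment {M : Type*} (f : ℕ → M) (i m : ℕ) (v : M) (j : ℕ) : M :=
  if j < i then f j else if j = i then v else f (j + m - 1)

theorem Tree.eval_graft {M : Type*} (op : Gen → M → M → M) (s t : Tree) (i : ℕ)
    (hi : i < s.arity) (f : ℕ → M) :
    (s.graft i t).eval op f =
      s.eval op (graftAssignment f i t.arity (t.eval op fun j => f (i + j))) := by
  induction s generalizing i f with
  | one =>
    obtain rfl : i = 0 := by simpa [arity] using hi
    simp [graft, eval, graftAssignment]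
  | node c l r hl hr =>
    have ht := t.arity_pos
    simp only [arity] at hi
    by_cases h : i < l.arity
    · simp only [graft, h, if_true, eval, hl i h, arity_graft l i h]
      congr 1
      apply eval_congr
      intro j _
      simp only [graftAssignment]
      rw [if_neg (by omega), if_neg (by omega)]
      congr 1
      omega
    · simp only [graft, h, if_false, eval, hr (i - l.arity) (by omega)]
      congr 1
      · apply eval_congr
        intro j hj
        simp only [graftAssignment]
        rw [if_pos (by omega)]
      · apply eval_congr
        intro j _
        simp only [graftAssignment]
        have e : ∀ j, l.arity + (i - l.arity + j) = i + j := by omega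
        simp only [e]
        by_cases h1 : j < i - l.arity
        · rw [if_pos h1, if_pos (by omega)]
        · by_cases h2 : j = i - l.arity
          · rw [if_neg h1, if_pos h2, if_neg (by omega), if_pos (by omega)]
          · rw [if_neg h1, if_neg h2, if_neg (by omega), if_neg (by omega)]
            congr 1
            omega

/-! ### The identities of a magma as an operadic ideal. -/

section Ideal

variable (k : Type*) [Field k]

/-- The value of an element of the free operad in the linearisation of a magma with two
operations. -/
noncomputable def evalLinear {M : Type*} (op : Gen → M → M → M) (n : ℕ) (f : ℕ → M) :
    Free k n →ₗ[k] (M →₀ k) :=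
  Finsupp.lmapDomain k k fun s : TreeMon n => s.1.eval op f

variable {k}

theorem evalLinear_single {M : Type*} (op : Gen → M → M → M) {n : ℕ} (f : ℕ → M)
    (s : TreeMon n) (a : k) :
    evalLinear k op n f (Finsupp.single s a) = Finsupp.single (s.1.eval op f) a :=
  Finsupp.mapDomain_single

theorem evalLinear_comp {M : Type*} (op : Gen → M → M → M) {n m : ℕ} (F : Free k n) (i : Fin n)
    (G : Free k m) (f : ℕ → M) :
    evalLinear k op _ f (F.comp i G) = G.sum fun t b =>
      b • evalLinear k op n (graftAssignment f i m (t.1.eval op fun j => f (i + j))) F := by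
  have h : ∀ (t : TreeMon m) (b : k),
      b • evalLinear k op n (graftAssignment f i m (t.1.eval op fun j => f (i + j))) F =
        F.sum fun s a => Finsupp.single ((s.comp i t).1.eval op f) (a * b) := by
    intro t b
    rw [evalLinear, Finsupp.lmapDomain_apply, Finsupp.mapDomain, Finsupp.smul_sum]
    refine Finsupp.sum_congr fun s _ => ?_
    rw [Finsupp.smul_single, smul_eq_mul, mul_comm]
    congr 1
    rw [TreeMon.comp, Tree.eval_graft op s.1 t.1 i (by rw [s.2]; exact i.2), t.2]
  simp only [h, Free.comp, map_finsuppSum, evalLinear_single]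
  exact Finsupp.sum_comm _ _ _

variable (k)

/-- The ideal of the identities, over the field `k`, of a magma with two operations. -/
noncomputable def identities {M : Type*} (op : Gen → M → M → M) : OperadicIdeal k where
  carrier n := ⨅ f : ℕ → M, LinearMap.ker (evalLinear k op n f)
  comp_mem_left F i G hF := by
    simp only [Submodule.mem_iInf, LinearMap.mem_ker] at hF ⊢
    intro f
    rw [evalLinear_comp]
    simp [hF]
  comp_mem_right {n m} F i G hG := by
    simp only [Submodule.mem_iInf, LinearMap.mem_ker] at hG ⊢
    intro f
    -- For a fixed `s`, the value of the composite depends on `G` only through the value at leaf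
    -- `i`. It is therefore the pushforward of the evaluation of `G`, which vanishes.
    have h := congrArg (fun H => F.sum fun s a => a • Finsupp.lmapDomain k k
      (fun v => s.1.eval op (graftAssignment f i m v)) H) (hG fun j => f (i + j))
    simp only [map_zero, smul_zero] at h
    refine Eq.trans ?_ (h.trans Finset.sum_const_zero)
    simp only [Free.comp, map_finsuppSum, evalLinear_single]
    refine Finsupp.sum_congr fun s _ => ?_
    simp only [evalLinear, Finsupp.lmapDomain_apply]
    rw [← Finsupp.mapDomain_comp, Finsupp.mapDomain, Finsupp.smul_sum]
    refine Finsupp.sum_congr fun t _ => ?_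
    rw [Function.comp_apply, Finsupp.smul_single, smul_eq_mul,
      TreeMon.comp, Tree.eval_graft op s.1 t.1 i (by rw [s.2]; exact i.2), t.2]

theorem bicomRelations_subset_identities :
    bicomRelations k ⊆ (identities k BalancedPath.op).carrier 3 := by
  have h : ∀ c : Gen, Finsupp.single (rightMon c c.other) 1 -
      Finsupp.single (leftMon c.other c) 1 ∈ (identities k BalancedPath.op).carrier 3 := by
    intro c
    simp only [identities, Submodule.mem_iInf, LinearMap.mem_ker, map_sub, evalLinear_single]
    intro f
    rw [sub_eq_zero]
    congr 1
    exact BalancedPath.op_op c _ _ _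
  rintro _ (rfl | rfl)
  exacts [h .y, h .x]

theorem span_carrier_le_identities (n : ℕ) :
    (OperadicIdeal.span k (bicomRelations k)).carrier n ≤
      (identities k BalancedPath.op).carrier n := by
  intro F hF
  simp only [OperadicIdeal.span, Submodule.mem_iInf] at hF
  exact hF _ (bicomRelations_subset_identities k)

/-! ### Linear independence of the normal monomials. -/

/-- The path of a tree in the path model. -/
def Tree.modelPath (t : Tree) : BalancedPath := t.eval BalancedPath.op fun _ => ⟨[], rfl⟩

/-- On monochromatic trees the right factor never leaves its side, so the closing step is inserted
at the very end. -/
theorem Tree.isDyck_modelPath {c : Gen} : ∀ {t : Tree}, t.OnlyLabel c → IsDyck c t.modelPath.1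
  | one, _ => isDyck_nil c
  | node d u a, h => by
    obtain ⟨rfl, hu, ha⟩ := h
    have h1 := isDyck_modelPath ha
    have h2 := (isDyck_modelPath hu).append h1.wrap
    have e := insertClosing_eq_concat d a.modelPath.1 0
      fun p hp => by simpa using h1.2 p hp
    simp only [modelPath] at *
    simpa [eval, BalancedPath.op, e] using h2

theorem Tree.modelPath_node {c : Gen} {u a : Tree} (ha : a.OnlyLabel c) :
    (node c u a).modelPath.1 =
      (u.modelPath.1 ++ c.opening :: a.modelPath.1) ++ [c.closing] := by
  have e := insertClosing_eq_concat c a.modelPath.1 0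
    fun p hp => by simpa using (isDyck_modelPath ha).2 p hp
  simp only [modelPath] at *
  simp [eval, BalancedPath.op, e]

/-- This coding differs from `pathOf`: monochromatic right subtrees are also cut at the last
excursion, where `dyckWord` cuts at the first return. The same recursion therefore decodes both
factors. -/
theorem Tree.modelPath_inj : ∀ {s t : Tree}, s.Normal → t.Normal →
    s.modelPath.1 = t.modelPath.1 → s = t
  | .one, .one, _, _, _ => rfl
  | .one, .node d v b, _, ht, h => by
    rw [modelPath_node ((normal_node_iff_onlyLabel d v b).1 ht).2] at h
    simp [modelPath, eval] at h
  | .node c u a, .one, hs, _, h => by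
    rw [modelPath_node ((normal_node_iff_onlyLabel c u a).1 hs).2] at h
    simp [modelPath, eval] at h
  | .node c u a, .node d v b, hs, ht, h => by
    obtain ⟨hu, ha⟩ := (normal_node_iff_onlyLabel c u a).1 hs
    obtain ⟨hv, hb⟩ := (normal_node_iff_onlyLabel d v b).1 ht
    rw [modelPath_node ha, modelPath_node hb] at h
    obtain ⟨h1, h2⟩ := List.append_inj' h rfl
    obtain rfl : c = d := closing_injective (by simpa using h2)
    obtain ⟨h3, h4⟩ := append_opening_cons_inj (height_eq_zero_of c u.modelPath.2)
      (height_eq_zero_of c v.modelPath.2) (isDyck_modelPath ha) (isDyck_modelPath hb) h1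
    rw [modelPath_inj hu hv h3, modelPath_inj ha.normal hb.normal h4]

theorem linearIndependent_monomialClass (n : ℕ) :
    LinearIndependent k
      (fun t : {t : TreeMon n // t.1.Normal} => monomialClass k t.1) := by
  let L : Component k n →ₗ[k] (BalancedPath →₀ k) :=
    Submodule.liftQ _ (evalLinear k BalancedPath.op n fun _ => ⟨[], rfl⟩)
      ((span_carrier_le_identities k n).trans (iInf_le _ _))
  -- It suffices that the images under `L` are independent; they are distinct basis vectors.
  apply LinearIndependent.of_comp L
  have hL : L ∘ (fun t : {t : TreeMon n // t.1.Normal} => monomialClass k t.1) =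
      (fun p : BalancedPath => Finsupp.single p (1 : k)) ∘ fun t => t.1.1.modelPath := by
    funext t
    exact evalLinear_single BalancedPath.op _ t.1 1
  rw [hL]
  refine (Finsupp.linearIndependent_single_one k BalancedPath).comp _ fun s t h => ?_
  exact Subtype.ext (Subtype.ext (Tree.modelPath_inj s.2 t.2 (congrArg Subtype.val h)))

/-! ### Reduction to normal trees -/

/-- Two trees of the same arity with the same class in the operad. -/
def Cong (s t : Tree) : Prop :=
  ∃ (n : ℕ) (hs : s.arity = n) (ht : t.arity = n),
    Finsupp.single (⟨s, hs⟩ : TreeMon n) (1 : k) - Finsupp.single ⟨t, ht⟩ 1 ∈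
      (OperadicIdeal.span k (bicomRelations k)).carrier n

variable {k}

theorem Cong.refl (t : Tree) : Cong k t t :=
  ⟨t.arity, rfl, rfl, by rw [sub_self]; exact Submodule.zero_mem _⟩

theorem Cong.symm {s t : Tree} : Cong k s t → Cong k t s := by
  rintro ⟨n, hs, ht, h⟩
  exact ⟨n, ht, hs, by rw [← neg_sub]; exact Submodule.neg_mem _ h⟩

theorem Cong.trans {s t u : Tree} : Cong k s t → Cong k t u → Cong k s u := by
  rintro ⟨n, hs, rfl, h⟩ ⟨m, rfl, hu, h'⟩
  exact ⟨_, hs, hu, by simpa using Submodule.add_mem _ h h'⟩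

theorem Free.comp_single_single {n m : ℕ} (s : TreeMon n) (i : Fin n) (t : TreeMon m) :
    Free.comp (Finsupp.single s (1 : k)) i (Finsupp.single t 1) =
      Finsupp.single (s.comp i t) 1 := by
  rw [Free.comp, Finsupp.sum_single_index, Finsupp.sum_single_index, one_mul] <;> simp

theorem Free.comp_sub_left {n m : ℕ} (F F' : Free k n) (i : Fin n) (G : Free k m) :
    (F - F').comp i G = F.comp i G - F'.comp i G := by
  simp only [Free.comp]
  refine Finsupp.sum_sub_index fun s a b => ?_
  simp only [sub_mul, Finsupp.single_sub]
  exact Finsupp.sum_sub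

theorem Free.comp_sub_right {n m : ℕ} (F : Free k n) (i : Fin n) (G G' : Free k m) :
    F.comp i (G - G') = F.comp i G - F.comp i G' := by
  simp only [Free.comp]
  rw [← Finsupp.sum_sub]
  refine Finsupp.sum_congr fun s _ => ?_
  refine Finsupp.sum_sub_index fun t a b => ?_
  simp only [mul_sub, Finsupp.single_sub]

theorem Cong.graft_left {s s' : Tree} (h : Cong k s s') (i : ℕ) (hi : i < s.arity) (u : Tree) :
    Cong k (s.graft i u) (s'.graft i u) := by
  obtain ⟨n, rfl, hs', h⟩ := h
  have := (OperadicIdeal.span k (bicomRelations k)).comp_mem_left _ ⟨i, hi⟩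
    (Finsupp.single (⟨u, rfl⟩ : TreeMon u.arity) 1) h
  rw [Free.comp_sub_left, Free.comp_single_single, Free.comp_single_single] at this
  exact ⟨_, _, _, this⟩

theorem Cong.graft_right {s s' : Tree} (h : Cong k s s') (u : Tree) (i : ℕ) (hi : i < u.arity) :
    Cong k (u.graft i s) (u.graft i s') := by
  obtain ⟨n, rfl, hs', h⟩ := h
  have := (OperadicIdeal.span k (bicomRelations k)).comp_mem_right
    (Finsupp.single (⟨u, rfl⟩ : TreeMon u.arity) 1) ⟨i, hi⟩ _ h
  rw [Free.comp_sub_right, Free.comp_single_single, Free.comp_single_single] at this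
  exact ⟨_, _, _, this⟩

theorem Cong.node {c : Gen} {l l' r r' : Tree} (hl : Cong k l l') (hr : Cong k r r') :
    Cong k (.node c l r) (.node c l' r') := by
  have h1 := hl.graft_right (.node c .one r) 0 (by simp [Tree.arity])
  have h2 := hr.graft_right (.node c l' .one) l'.arity (by simp [Tree.arity])
  simp only [Tree.graft, Tree.arity, Nat.one_pos, if_true, lt_irrefl, if_false] at h1 h2
  exact h1.trans h2

theorem Cong.relation (c : Gen) (a b d : Tree) :
    Cong k (.node c a (.node c.other b d)) (.node c.other (.node c a b) d) := by
  have h : Cong k (.node c .one (.node c.other .one .one))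
      (.node c.other (.node c .one .one) .one) := by
    refine ⟨3, rfl, rfl, ?_⟩
    simp only [OperadicIdeal.span, Submodule.mem_iInf]
    intro J hJ
    apply hJ
    cases c
    exacts [Or.inr rfl, Or.inl rfl]
  -- Grafting from right to left keeps the numbers of the remaining leaves.
  have h3 := ((h.graft_left 2 (by simp [Tree.arity]) d).graft_left 1
    (by simp [Tree.arity, Tree.graft]) b).graft_left 0 (by simp [Tree.arity, Tree.graft]) a
  simpa [Tree.graft, Tree.arity] using h3

/-- A vertex of the other label moves up to the root: one direction of the relations lifts it from a
right child, the opposite direction from a left child. -/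
theorem Cong.onlyLabel_or (k : Type*) [Field k] (c : Gen) (t : Tree) :
    t.OnlyLabel c ∨ ∃ a b, Cong k t (.node c.other a b) := by
  induction t with
  | one => exact Or.inl trivial
  | node d l r hl hr =>
    rcases c.eq_or_eq_other d with rfl | rfl
    · rcases hl with hl | ⟨a, b, hl⟩
      · rcases hr with hr | ⟨a, b, hr⟩
        · exact Or.inl ⟨rfl, hl, hr⟩
        · exact Or.inr ⟨_, _, ((Cong.refl l).node hr).trans (Cong.relation d l a b)⟩
      · have h := Cong.relation (k := k) d.other a b r
        rw [Gen.other_other] at h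
        exact Or.inr ⟨_, _, (hl.node (Cong.refl r)).trans h.symm⟩
    · exact Or.inr ⟨l, r, Cong.refl _⟩

/-- The operation `c` is associative if the middle argument is not a product for `c` alone. -/
theorem Cong.assoc {c : Gen} {w p q : Tree} (hw : Cong k w (.node c.other p q)) (a d : Tree) :
    Cong k (.node c a (.node c w d)) (.node c (.node c a w) d) := by
  have h1 : Cong k (.node c (.node c.other p q) d) (.node c.other p (.node c q d)) := by
    have h := Cong.relation (k := k) c.other p q d
    rw [Gen.other_other] at h
    exact h.symm
  have h2 : Cong k (.node c (.node c.other (.node c a p) q) d)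
      (.node c.other (.node c a p) (.node c q d)) := by
    have h := Cong.relation (k := k) c.other (.node c a p) q d
    rw [Gen.other_other] at h
    exact h.symm
  have h3 : Cong k (.node c a w) (.node c.other (.node c a p) q) :=
    ((Cong.refl a).node hw).trans (Cong.relation c a p q)
  exact ((Cong.refl a).node ((hw.node (Cong.refl d)).trans h1)).trans
    ((Cong.relation c a p _).trans (h2.symm.trans (h3.symm.node (Cong.refl d))))

/-- Unless the product is already normal, a relation or `Cong.assoc` turns `c(u, d(w, g))` into
`d(c(u, w), g)`. The induction then runs down the left spine of `v`, and `g` is already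
monochromatic. -/
theorem Cong.exists_normal_node (k : Type*) [Field k] (c : Gen) {u : Tree} (hu : u.Normal)
    (v : Tree) (hv : v.Normal) : ∃ s : Tree, s.Normal ∧ Cong k (.node c u v) s := by
  induction v with
  | one => exact ⟨_, (Tree.normal_node_iff_onlyLabel c u .one).2 ⟨hu, trivial⟩, Cong.refl _⟩
  | node d w g ih _ =>
    obtain ⟨hw, hg⟩ := (Tree.normal_node_iff_onlyLabel d w g).1 hv
    obtain ⟨s, hs, hcs⟩ := ih hw
    have hn : (Tree.node d s g).Normal := (Tree.normal_node_iff_onlyLabel d s g).2 ⟨hs, hg⟩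
    rcases c.eq_or_eq_other d with rfl | rfl
    · rcases Cong.onlyLabel_or k d w with h | ⟨p, q, h⟩
      · exact ⟨_, (Tree.normal_node_iff_onlyLabel d u (.node d w g)).2 ⟨hu, rfl, h, hg⟩, Cong.refl _⟩
      · exact ⟨_, hn, (h.assoc u g).trans (hcs.node (Cong.refl g))⟩
    · exact ⟨_, hn, (Cong.relation c u w g).trans (hcs.node (Cong.refl g))⟩

theorem Cong.exists_normal (k : Type*) [Field k] (t : Tree) :
    ∃ s : Tree, s.Normal ∧ Cong k t s := by
  induction t with
  | one => exact ⟨_, Tree.normal_one, Cong.refl _⟩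
  | node c u v hu hv =>
    obtain ⟨u', hu', hu⟩ := hu
    obtain ⟨v', hv', hv⟩ := hv
    obtain ⟨s, hs, h⟩ := Cong.exists_normal_node k c hu' v' hv'
    exact ⟨s, hs, (hu.node hv).trans h⟩

/-! ### Spanning and dimension. -/

variable (k)

theorem span_monomialClass (n : ℕ) :
    Submodule.span k
      (Set.range fun t : {t : TreeMon n // t.1.Normal} => monomialClass k t.1) = ⊤ := by
  rw [eq_top_iff]
  rintro x -
  obtain ⟨F, rfl⟩ := Submodule.Quotient.mk_surjective _ x
  induction F using Finsupp.induction_linear with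
  | zero => exact Submodule.zero_mem _
  | add F G hF hG =>
    rw [Submodule.Quotient.mk_add]
    exact Submodule.add_mem _ hF hG
  | single t a =>
    obtain ⟨t, rfl⟩ := t
    obtain ⟨s, hs, m, rfl, hsm, h⟩ := Cong.exists_normal k t
    have e : (Finsupp.single (⟨t, rfl⟩ : TreeMon t.arity) a : Free k t.arity) =
        a • Finsupp.single ⟨t, rfl⟩ 1 := by simp
    rw [e, Submodule.Quotient.mk_smul, (Submodule.Quotient.eq _).2 h]
    exact Submodule.smul_mem _ _ (Submodule.subset_span ⟨⟨⟨s, hsm⟩, hs⟩, rfl⟩)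

theorem finrank_component (n : ℕ) (hn : 1 ≤ n) :
    Module.finrank k (Component k n) = (2 * n - 2).choose (n - 1) := by
  rw [Module.finrank_eq_nat_card_basis (Module.Basis.mk (linearIndependent_monomialClass k n)
    (span_monomialClass k n).ge)]
  have e : {t : TreeMon n // t.1.Normal} ≃ {t : Tree | t.Normal ∧ t.arity = n} :=
    { toFun := fun t => ⟨t.1.1, t.2, t.1.2⟩
      invFun := fun t => ⟨⟨t.1, t.2.2⟩, t.2.1⟩
      left_inv := fun _ => rfl
      right_inv := fun _ => rfl }
  rw [Nat.card_congr (e.trans (bijOn_pathOf n hn).equiv), Nat.card_coe_set_eq,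
    ncard_latticePaths, Nat.mul_sub]

end Ideal

end NoncomBicom
theorem mainTheorem7 (k : Type*) [Field k] (n : ℕ) (hn : 1 ≤ n) :
    Module.finrank k (NoncomBicom.Component k n) = Nat.choose (2 * n - 2) (n - 1) ∧
    (LinearIndependent k
        (fun t : {t : NoncomBicom.TreeMon n // t.1.Normal} =>
          NoncomBicom.monomialClass k t.1) ∧
      Submodule.span k
        (Set.range fun t : {t : NoncomBicom.TreeMon n // t.1.Normal} =>
          NoncomBicom.monomialClass k t.1) = ⊤) ∧
    (∀ t : NoncomBicom.Tree, t.Normal ↔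
      t = .one ∨
      (∃ u α : NoncomBicom.Tree, u.Normal ∧ α.OnlyLabel .x ∧ t = .node .x u α) ∨
      (∃ u β : NoncomBicom.Tree, u.Normal ∧ β.OnlyLabel .y ∧ t = .node .y u β)) ∧
    Set.BijOn NoncomBicom.pathOf
      {t : NoncomBicom.Tree | t.Normal ∧ t.arity = n}
      (NoncomBicom.latticePaths (n - 1)) :=
  ⟨NoncomBicom.finrank_component k n hn,
    ⟨NoncomBicom.linearIndependent_monomialClass k n, NoncomBicom.span_monomialClass k n⟩,
    NoncomBicom.Tree.normal_iff, NoncomBicom.bijOn_pathOf n hn⟩
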